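/- An index coding problem is given by a finite directed graph $G$ without self-loops on the vertex set $[1:n]$. An edge $i\to j$ means that receiver $j$ knows message $i$ in advance; put $A_j=\{i : i\to j\}$. For integers $t_1,\dots,t_n\ge 0$ and $r\ge 1$, a $(t_1,\dots,t_n,r)$ index code consists of an encoder $\phi:\prod_{i=1}^n\{0,1\}^{t_i}\to\{0,1\}^r$ and decoders $\psi_j:\{0,1\}^r\times\prod_{k\in A_j}\{0,1\}^{t_k}\to\{0,1\}^{t_j}$, $j\in[1:n]$, such that $\psi_j(\phi(x^n),(x_k)_{k\in A_j})=x_j$ for every message tuple $x^n=(x_1,\dots,x_n)$ and every $j$. A tuple $(R_1,\dots,R_n)$ of nonnegative reals is achievable if there is a $(t_1,\dots,t_n,r)$ index code with $R_j\le t_j/r$ for all $j\in[1:n]$. The capacity region of $G$ is the closure in $\mathbb{R}^n$ of the set of achievable tuples. **Theorem 2.** Let $n=n_1+n_2$, let $G_1$ and $G_2$ be the subgraphs of $G$ induced by $[1:n_1]$ and $[n_1+1:n]$, and let $\mathscr{C},\mathscr{C}_1,\mathscr{C}_2$ be the capacity regions of $G,G_1,G_2$, respectively. If $G$ has no edge from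 a vertex of $G_2$ to a vertex of $G_1$, then \[ \mathscr{C}=\bigcup_{\alpha\in[0,1]}\bigl\{(\alpha\mathbf{R}_1,(1-\alpha)\mathbf{R}_2) : \mathbf{R}_1\in\mathscr{C}_1,\ \mathbf{R}_2\in\mathscr{C}_2\bigr\}. \] -/

import Mathlib

namespace IndexCoding

/-- The message tuples with message lengths `t`: the message `x i` is a string of `t i` bits. -/
abbrev MessageTuple {V : Type*} (t : V → ℕ) : Type _ :=
  ∀ i : V, Fin (t i) → Bool

/-- A `(t, r)` index code for the index coding problem with side information graph `G`.
The vertices are both the messages and the receivers; an edge `i → j` means that receiver `j`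
has message `i` as side information. The encoder maps message tuples to `r`-bit indices, and
decoder `j` recovers message `j` from the index and the side information of receiver `j`. -/
structure IndexCode {V : Type*} (G : Digraph V) (t : V → ℕ) (r : ℕ) where
  encode : MessageTuple t → (Fin r → Bool)
  decode : ∀ j : V,
    (Fin r → Bool) → (∀ k : {k : V // G.Adj k j}, Fin (t k) → Bool) → (Fin (t j) → Bool)
  decode_encode : ∀ (x : MessageTuple t) (j : V),
    decode j (encode x) (fun k => x k) = x j

/-- A tuple of (nonnegative) rates is achievable if some index code has at least these rates. -/
def Achievable {V : Type*} (G : Digraph V) (R : V → ℝ) : Prop :=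
  (∀ j, 0 ≤ R j) ∧
    ∃ (t : V → ℕ) (r : ℕ), 0 < r ∧ Nonempty (IndexCode G t r) ∧
      ∀ j, R j ≤ (t j : ℝ) / (r : ℝ)

/-- The capacity region: the closure of the set of achievable rate tuples. -/
def capacityRegion {V : Type*} (G : Digraph V) : Set (V → ℝ) :=
  closure {R | Achievable G R}

/-- The subgraph of `G` induced by the first `m` vertices. -/
def firstPart {m n : ℕ} (G : Digraph (Fin (m + n))) : Digraph (Fin m) where
  Adj i j := G.Adj (Fin.castAdd n i) (Fin.castAdd n j)

/-- The subgraph of `G` induced by the last `n` vertices (renumbered from the start). -/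
def lastPart {m n : ℕ} (G : Digraph (Fin (m + n))) : Digraph (Fin n) where
  Adj i j := G.Adj (Fin.natAdd m i) (Fin.natAdd m j)

end IndexCoding

/-! An encoder is a coloring of message tuples whose color classes are independent: no receiver
confuses two members. Both inclusions are counts of such sets.

Converse: a code with `r` index bits has a class `S` containing at least a fraction `2 ^ (-r)` of
all tuples. By one-wayness, projecting `S` to the first messages gives an independent set, and so
does fixing the first messages and projecting to the last ones (`IsIndep.exists_parts`). Hence `#S ≤
#S₁ * #S₂`, which splits `r` as `a + (r - a)`. A large independent set in turn yields codes: its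
powers stay independent, and their translates cover all tuples with only a lower-order loss in index
length (`IsIndep.mem_capacityRegion`). So the two parts have rates in their own regions, weighted by
`a / r` and `1 - a / r`.

The direct inclusion is time sharing. The closure costs nothing because the regions are compact, so
the union is closed. -/

namespace IndexCoding

open Filter Topology Finset
open scoped Classical

/-! ### Independent sets, colorings and translates -/

section Independent

variable {V : Type*} (G : Digraph V) {t : V → ℕ}

/-- A set of message tuples no two of which can be confused by a receiver that is given only its
side information. -/
def IsIndep (S : Set (MessageTuple t)) : Prop :=
  ∀ x ∈ S, ∀ z ∈ S, ∀ j, (∀ k, G.Adj k j → x k = z k) → x j = z j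

/-- A map on message tuples whose fibers are independent. -/
def IsColoring {C : Type*} (c : MessageTuple t → C) : Prop :=
  ∀ y, IsIndep G {x | c x = y}

variable {G}

theorem IsIndep.mono {S S' : Set (MessageTuple t)} (hS : IsIndep G S) (h : S' ⊆ S) :
    IsIndep G S' :=
  fun x hx z hz => hS x (h hx) z (h hz)

theorem IndexCode.isColoring_encode {r : ℕ} (c : IndexCode G t r) : IsColoring G c.encode := by
  intro y x hx z hz j h
  rw [← c.decode_encode x j, ← c.decode_encode z j, show c.encode x = y from hx,
    show c.encode z = y from hz]
  congr 1
  funext k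
  exact h k k.2

/-- A decoder may pick any tuple consistent with the index and its side information: independence of
the color class makes its own message the same for every choice. -/
theorem IsColoring.nonempty_indexCode {C : Type*} [Fintype C] {c : MessageTuple t → C}
    (hc : IsColoring G c) {r : ℕ} (hr : Fintype.card C ≤ 2 ^ r) :
    Nonempty (IndexCode G t r) := by
  obtain ⟨e⟩ : Nonempty (C ↪ (Fin r → Bool)) :=
    Function.Embedding.nonempty_of_card_le (by simpa using hr)
  refine ⟨⟨fun x => e (c x), fun j y s =>
    if h : ∃ x, e (c x) = y ∧ (∀ k : {k : V // G.Adj k j}, x k = s k) then h.choose j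
    else fun _ => false, fun x j => ?_⟩⟩
  have h : ∃ x', e (c x') = e (c x) ∧ (∀ k : {k : V // G.Adj k j}, x' k = x k) :=
    ⟨x, rfl, fun _ => rfl⟩
  rw [dif_pos h]
  exact hc (c x) _ (e.injective h.choose_spec.1) _ rfl j
    fun k hk => h.choose_spec.2 ⟨k, hk⟩

/-- Tuples of messages of `k` times the length are `k`-tuples of message tuples. -/
def copies (t : V → ℕ) (k : ℕ) :
    MessageTuple (fun i => k * t i) ≃ (Fin k → MessageTuple t) where
  toFun x s i b := x i (finProdFinEquiv (s, b))
  invFun y i b := y (finProdFinEquiv.symm b).1 i (finProdFinEquiv.symm b).2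
  left_inv x := by
    funext i b
    change x i (finProdFinEquiv (finProdFinEquiv.symm b)) = x i b
    rw [Equiv.apply_symm_apply]
  right_inv y := by
    funext s i b
    simp only [Equiv.symm_apply_apply]

theorem IsIndep.setOf_copies {k : ℕ} {S : Fin k → Set (MessageTuple t)} (hS : ∀ s, IsIndep G (S s)) :
    IsIndep G {x | ∀ s, copies t k x s ∈ S s} := by
  intro x hx z hz j h
  have key : ∀ s, copies t k x s j = copies t k z s j := fun s =>
    hS s _ (hx s) _ (hz s) j fun i hi => by
      funext b
      exact congrFun (h i hi) _
  funext b
  have := congrFun (key (finProdFinEquiv.symm b).1) (finProdFinEquiv.symm b).2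
  change x j (finProdFinEquiv (finProdFinEquiv.symm b)) =
    z j (finProdFinEquiv (finProdFinEquiv.symm b)) at this
  rwa [Equiv.apply_symm_apply] at this

theorem IsColoring.comp_copies {C : Type*} {c : MessageTuple t → C} (hc : IsColoring G c) (k : ℕ) :
    IsColoring G (fun x s => c (copies t k x s)) := fun y =>
  (IsIndep.setOf_copies fun s => hc (y s)).mono fun _ hx s => congrFun hx s

/-- Bitwise exclusive or with a fixed message tuple. -/
def translate (g : MessageTuple t) : MessageTuple t → MessageTuple t :=
  fun x i b => xor (g i b) (x i b)

theorem translate_comm (g x : MessageTuple t) : translate g x = translate x g := by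
  funext i b
  exact Bool.xor_comm _ _

theorem translate_involutive (g : MessageTuple t) : Function.Involutive (translate g) := by
  intro x
  funext i b
  simp [translate]

theorem IsIndep.setOf_translate {S : Set (MessageTuple t)} (hS : IsIndep G S) (g : MessageTuple t) :
    IsIndep G {x | translate g x ∈ S} := by
  intro x hx z hz j h
  have := hS _ hx _ hz j fun k hk => by
    funext b
    simp [translate, h k hk]
  funext b
  simpa [translate] using congrFun this b

variable [Fintype V]

theorem card_messageTuple (t : V → ℕ) : Fintype.card (MessageTuple t) = 2 ^ ∑ i, t i := by
  simp [MessageTuple, Fintype.card_pi, Finset.prod_pow_eq_pow_sum]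

/-- Translation is symmetric in its two arguments and involutive. The count is the same for every
`x`, which is the uniformity that greedy covering requires. -/
theorem card_filter_translate (S : Finset (MessageTuple t)) (x : MessageTuple t) :
    #{g | translate g x ∈ S} = #S := by
  refine Finset.card_bij' (fun g _ => translate x g) (fun g _ => translate x g) ?_ ?_ ?_ ?_
  · intro g hg
    rw [translate_comm]
    simpa using hg
  · intro g hg
    simpa [translate_comm _ x, translate_involutive x g] using hg
  · intro g _
    exact translate_involutive x g
  · intro g _
    exact translate_involutive x g

/-- An index code has an independent fiber of at least the average size. -/
theorem IndexCode.exists_isIndep {r : ℕ} (c : IndexCode G t r) :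
    ∃ S : Finset (MessageTuple t), IsIndep G (S : Set (MessageTuple t)) ∧
      2 ^ (∑ i, t i) ≤ 2 ^ r * #S := by
  obtain ⟨y, hy⟩ := Finite.exists_max fun y : Fin r → Bool => #{x | c.encode x = y}
  refine ⟨({x | c.encode x = y} : Finset _), (c.isColoring_encode y).mono (by simp), ?_⟩
  rw [← card_messageTuple, ← Finset.card_univ,
    Finset.card_eq_sum_card_fiberwise (f := c.encode) (t := Finset.univ) (by simp)]
  refine (Finset.sum_le_card_nsmul _ _ _ fun z _ => hy z).trans ?_
  simp

theorem IsIndep.card_mul_le (loopless : ∀ j, ¬ G.Adj j j) {S : Finset (MessageTuple t)}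
    (hS : IsIndep G (S : Set (MessageTuple t))) (j : V) :
    #S * 2 ^ t j ≤ 2 ^ ∑ i, t i := by
  -- Overwriting message `j` loses nothing: with no loop at `j`, the other messages include all side
  -- information of `j`, so within `S` they determine message `j`.
  have hinj : Function.Injective
      (fun (p : S × (Fin (t j) → Bool)) => Function.update p.1.1 j p.2) := by
    rintro ⟨⟨x, hx⟩, u⟩ ⟨⟨z, hz⟩, w⟩ h
    have huw : u = w := by simpa using congrFun h j
    have hne : ∀ k, k ≠ j → x k = z k := fun k hk => by simpa [hk] using congrFun h k
    have hj : x j = z j := hS x hx z hz j fun k hk => hne k fun e => loopless j (e ▸ hk)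
    have hxz : x = z := by
      funext k
      by_cases hk : k = j
      · subst hk
        exact hj
      · exact hne k hk
    subst huw hxz
    rfl
  have := Fintype.card_le_of_injective _ hinj
  rw [card_messageTuple] at this
  simpa using this

end Independent

/-! ### Greedy covering -/

/-- Greedy covering: if every point lies in exactly `d` of the sets `B g`, some `N` of these sets
leave at most a fraction `(1 - d / card ι) ^ N` of the points uncovered. -/
theorem exists_card_uncovered_le {X ι : Type*} [Fintype X] [Fintype ι] [Nonempty ι]
    (B : ι → Set X) (d : ℕ) (hB : ∀ x, #{g | x ∈ B g} = d) (N : ℕ) :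
    ∃ f : Fin N → ι, (#{x | ∀ s, x ∉ B (f s)} : ℝ) ≤
      Fintype.card X * (1 - d / Fintype.card ι : ℝ) ^ N := by
  have hι : (0 : ℝ) < Fintype.card ι := by exact_mod_cast Fintype.card_pos
  induction N with
  | zero => exact ⟨Fin.elim0, by simp⟩
  | succ N ih =>
    obtain ⟨f, hf⟩ := ih
    set U : Finset X := {x | ∀ s, x ∉ B (f s)} with hU
    have hd : d ≤ Fintype.card ι ∨ IsEmpty X := by
      rcases isEmpty_or_nonempty X with h | ⟨⟨x⟩⟩
      · exact Or.inr h
      · exact Or.inl (hB x ▸ Finset.card_le_univ _)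
    rcases hd with hd | hX
    swap
    · obtain ⟨g⟩ := ‹Nonempty ι›
      exact ⟨fun _ => g, by simp⟩
    have hmiss : ∀ x, (#{g | x ∉ B g} : ℝ) = Fintype.card ι - d := by
      intro x
      have := Finset.card_filter_add_card_filter_not (s := (univ : Finset ι)) (fun g => x ∈ B g)
      rw [hB, Finset.card_univ] at this
      rw [← this]
      push_cast
      ring
    -- Double counting: this is the average over `g` of what remains uncovered, so some `g` does at
    -- least as well.
    have hsum : ∑ g, (#{x ∈ U | x ∉ B g} : ℝ) =
        ∑ _g : ι, (#U * (1 - d / Fintype.card ι : ℝ)) := by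
      have : ∑ g, (#{x ∈ U | x ∉ B g} : ℝ) = ∑ x ∈ U, (#{g | x ∉ B g} : ℝ) := by
        exact_mod_cast Finset.sum_card_bipartiteAbove_eq_sum_card_bipartiteBelow
          (s := (univ : Finset ι)) (t := U) (fun g x => x ∉ B g)
      rw [this, Finset.sum_congr rfl fun x _ => hmiss x]
      simp only [Finset.sum_const, nsmul_eq_mul, Finset.card_univ]
      field_simp
    obtain ⟨g, -, hg⟩ := Finset.exists_le_of_sum_le Finset.univ_nonempty hsum.le
    refine ⟨Fin.cons g f, ?_⟩
    have hset : ({x | ∀ s, x ∉ B ((Fin.cons g f : Fin (N + 1) → ι) s)} : Finset X) =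
        {x ∈ U | x ∉ B g} := by
      ext x
      simp [hU, Fin.forall_fin_succ, and_comm]
    rw [hset]
    have hp : (0 : ℝ) ≤ 1 - d / Fintype.card ι := by
      rw [sub_nonneg, div_le_one hι]
      exact_mod_cast hd
    calc _ ≤ _ := hg
      _ ≤ _ := mul_le_mul_of_nonneg_right hf hp
      _ = _ := by ring

/-! ### From independent sets to rates -/

section Rates

variable {V : Type*} [Fintype V] {G : Digraph V} {t : V → ℕ}

/-- The translates of an independent set that has a fraction at least `2 ^ (m - r)` of all
tuples contain a cover by `2 ^ r` sets, if `2 ^ m` exceeds the number of message bits. -/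
theorem IsIndep.nonempty_indexCode {S : Finset (MessageTuple t)}
    (hS : IsIndep G (S : Set (MessageTuple t))) {r m : ℕ}
    (hcard : (2 : ℝ) ^ m * 2 ^ (∑ i, t i) ≤ #S * 2 ^ r) (hm : ∑ i, t i < 2 ^ m) :
    Nonempty (IndexCode G t r) := by
  obtain ⟨f, hf⟩ := exists_card_uncovered_le
    (fun g : MessageTuple t => {x | translate g x ∈ S}) #S
    (fun x => by
      rw [← card_filter_translate S x]
      congr 1; ext g; simp)
    (2 ^ r)
  rw [card_messageTuple] at hf
  push_cast at hf
  set T := ∑ i, t i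
  have hle : (#S : ℝ) ≤ 2 ^ T := by
    have := Finset.card_le_univ S
    rw [card_messageTuple] at this
    exact_mod_cast this
  have hp : (1 - #S / 2 ^ T : ℝ) ^ 2 ^ r ≤ Real.exp (-(2 ^ m)) := by
    calc (1 - #S / 2 ^ T : ℝ) ^ 2 ^ r ≤ Real.exp (-(#S / 2 ^ T)) ^ 2 ^ r := by
          refine pow_le_pow_left₀ ?_ (Real.one_sub_le_exp_neg _) _
          rw [sub_nonneg, div_le_one (by positivity)]
          exact hle
      _ = Real.exp (-(#S * 2 ^ r / 2 ^ T)) := by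
          rw [← Real.exp_nat_mul]
          congr 1
          push_cast
          ring
      _ ≤ _ := by
          rw [Real.exp_le_exp, neg_le_neg_iff, le_div_iff₀ (by positivity)]
          exact hcard
  have hT : (2 : ℝ) ^ T < Real.exp (2 ^ m) := by
    calc (2 : ℝ) ^ T ≤ Real.exp 1 ^ T := by
          refine pow_le_pow_left₀ (by norm_num) ?_ _
          linarith [Real.add_one_le_exp 1]
      _ = Real.exp T := by rw [← Real.exp_nat_mul, mul_one]
      _ < _ := by
          rw [Real.exp_lt_exp]
          exact_mod_cast hm
  -- The number of uncovered tuples is a natural number below 1, so the cover is complete.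
  have hlt := hf.trans_lt (show (2 : ℝ) ^ T * (1 - #S / 2 ^ T) ^ 2 ^ r < 1 by
    calc _ ≤ (2 : ℝ) ^ T * Real.exp (-(2 ^ m)) := by gcongr
      _ < Real.exp (2 ^ m) * Real.exp (-(2 ^ m)) := by gcongr
      _ = 1 := by rw [← Real.exp_add, add_neg_cancel, Real.exp_zero])
  rw [Nat.cast_lt_one, Finset.card_eq_zero] at hlt
  have hcov : ∀ x, ∃ s, translate (f s) x ∈ S := by
    intro x
    by_contra! h
    exact Finset.notMem_empty x (hlt ▸ by simpa using h)
  choose c hc using hcov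
  have hcol : IsColoring G c := fun s =>
    (hS.setOf_translate (f s)).mono fun x hx => by
      have := hc x
      rw [show c x = s from hx] at this
      exact this
  exact hcol.nonempty_indexCode (by simp)

theorem eventually_sq_mul_lt_two_pow (T : ℕ) : ∀ᶠ m : ℕ in atTop, m ^ 2 * T < 2 ^ m := by
  have h := (tendsto_pow_const_div_const_pow_of_one_lt 2 (r := (2 : ℝ)) (by norm_num)).mul_const
    (T : ℝ)
  rw [zero_mul] at h
  filter_upwards [h.eventually_lt_const one_pos] with m hm
  have h2 : (0 : ℝ) < 2 ^ m := by positivity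
  rw [div_mul_eq_mul_div, div_lt_one h2] at hm
  exact_mod_cast hm

/-- An independent set of at least `2 ^ (T - a)` among the `2 ^ T` message tuples shows that the
rates `t j / a` lie in the capacity region. -/
theorem IsIndep.mem_capacityRegion {S : Finset (MessageTuple t)}
    (hS : IsIndep G (S : Set (MessageTuple t))) {a : ℝ} (ha : 0 < a)
    (hcard : (2 : ℝ) ^ (∑ i, t i) ≤ #S * 2 ^ a) {R : V → ℝ} (hR : ∀ j, 0 ≤ R j)
    (hRt : ∀ j, a * R j ≤ t j) : R ∈ capacityRegion G := by
  have hlim : Tendsto (fun m : ℕ => a / (a + (1 / (m : ℝ) + 1 / (m : ℝ) * (1 / (m : ℝ)))))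
      atTop (𝓝 1) := by
    have h0 := tendsto_one_div_atTop_nhds_zero_nat (𝕜 := ℝ)
    have : Tendsto (fun m : ℕ => a / (a + (1 / (m : ℝ) + 1 / (m : ℝ) * (1 / (m : ℝ)))))
        atTop (𝓝 (a / (a + (0 + 0 * 0)))) :=
      tendsto_const_nhds.div (tendsto_const_nhds.add (h0.add (h0.mul h0))) (by simpa using ha.ne')
    simpa only [mul_zero, add_zero, div_self ha.ne'] using this
  have hlimR := hlim.smul_const R
  rw [one_smul] at hlimR
  refine mem_closure_of_tendsto hlimR ?_
  filter_upwards [eventually_sq_mul_lt_two_pow (∑ i, t i), eventually_gt_atTop 0] with m hm hm0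
  have hm' : (0 : ℝ) < m := by exact_mod_cast hm0
  -- With `m ^ 2` copies, the `m` extra bits suffice for covering yet are negligible against `m ^ 2
  -- * a`. The scaling factor in `hlim` pays for them and for the rounding.
  refine ⟨fun j => ?_, fun i => m ^ 2 * t i, ⌈(m : ℝ) ^ 2 * a⌉₊ + m, by omega, ?_, fun j => ?_⟩
  · have := hR j
    simp only [Pi.smul_apply, smul_eq_mul]
    positivity
  · have hind : IsIndep G
        (({x | ∀ s, copies t (m ^ 2) x s ∈ S} : Finset (MessageTuple fun i => m ^ 2 * t i)) :
          Set (MessageTuple fun i => m ^ 2 * t i)) :=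
      (IsIndep.setOf_copies fun _ => hS).mono (by simp)
    refine hind.nonempty_indexCode (m := m) ?_ (by rwa [← Finset.mul_sum])
    have hpow : #({x | ∀ s, copies t (m ^ 2) x s ∈ S} :
        Finset (MessageTuple fun i => m ^ 2 * t i)) = #S ^ m ^ 2 := by
      rw [← Fintype.card_piFinset_const]
      refine Finset.card_equiv (copies t (m ^ 2)) fun x => ?_
      simp
    rw [hpow, ← Finset.mul_sum]
    push_cast
    calc (2 : ℝ) ^ m * 2 ^ (m ^ 2 * ∑ i, t i) = 2 ^ m * (2 ^ ∑ i, t i) ^ m ^ 2 := by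
          rw [mul_comm (m ^ 2), pow_mul]
      _ ≤ 2 ^ m * (#S * 2 ^ a) ^ m ^ 2 := by gcongr
      _ = #S ^ m ^ 2 * ((2 : ℝ) ^ ((m : ℝ) ^ 2 * a) * 2 ^ m) := by
          rw [mul_pow, ← Real.rpow_mul_natCast (by norm_num)]
          push_cast
          rw [mul_comm a]
          ring
      _ ≤ #S ^ m ^ 2 * ((2 : ℝ) ^ (⌈(m : ℝ) ^ 2 * a⌉₊ : ℝ) * 2 ^ m) := by
          gcongr
          · norm_num
          · exact Nat.le_ceil _
      _ = _ := by rw [Real.rpow_natCast, pow_add]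
  · have hr : ((⌈(m : ℝ) ^ 2 * a⌉₊ + m : ℕ) : ℝ) ≤ (m : ℝ) ^ 2 * a + m + 1 := by
      push_cast
      have := (Nat.ceil_lt_add_one (show 0 ≤ (m : ℝ) ^ 2 * a by positivity)).le
      linarith
    have hr0 : (0 : ℝ) < ((⌈(m : ℝ) ^ 2 * a⌉₊ + m : ℕ) : ℝ) := by
      exact_mod_cast (by omega : 0 < ⌈(m : ℝ) ^ 2 * a⌉₊ + m)
    simp only [Pi.smul_apply, smul_eq_mul]
    calc a / (a + (1 / (m : ℝ) + 1 / (m : ℝ) * (1 / (m : ℝ)))) * R j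
        = (m : ℝ) ^ 2 * (a * R j) / ((m : ℝ) ^ 2 * a + m + 1) := by
          field_simp
          ring
      _ ≤ (m : ℝ) ^ 2 * t j / ((m : ℝ) ^ 2 * a + m + 1) := by
          gcongr
          exact hRt j
      _ ≤ (m : ℝ) ^ 2 * t j / ((⌈(m : ℝ) ^ 2 * a⌉₊ + m : ℕ) : ℝ) := by gcongr
      _ = _ := by push_cast; rfl

theorem IsIndep.length_le (loopless : ∀ j, ¬ G.Adj j j) {S : Finset (MessageTuple t)}
    (hS : IsIndep G (S : Set (MessageTuple t))) {a : ℝ}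
    (hcard : (2 : ℝ) ^ (∑ i, t i) ≤ #S * 2 ^ a) (j : V) : (t j : ℝ) ≤ a := by
  have hpos : (0 : ℝ) < #S := by
    by_contra h
    have : (#S : ℝ) = 0 := le_antisymm (not_lt.mp h) (by positivity)
    rw [this, zero_mul] at hcard
    exact absurd hcard (not_le.mpr (by positivity))
  have h1 : (#S : ℝ) * 2 ^ t j ≤ 2 ^ ∑ i, t i := by
    exact_mod_cast hS.card_mul_le loopless j
  have h2 := le_of_mul_le_mul_left (h1.trans hcard) hpos
  rw [← Real.rpow_natCast] at h2
  exact (Real.rpow_le_rpow_left_iff (by norm_num)).mp h2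

theorem nonneg_of_two_pow_le {S : Finset (MessageTuple t)} {a : ℝ}
    (hcard : (2 : ℝ) ^ (∑ i, t i) ≤ #S * 2 ^ a) : 0 ≤ a := by
  have hle : (#S : ℝ) ≤ 2 ^ ∑ i, t i := by
    have := Finset.card_le_univ S
    rw [card_messageTuple] at this
    exact_mod_cast this
  have h : (2 : ℝ) ^ (∑ i, t i) * 1 ≤ 2 ^ (∑ i, t i) * 2 ^ a := by
    rw [mul_one]
    exact hcard.trans (by gcongr)
  have h1 := le_of_mul_le_mul_left h (by positivity)
  rw [← Real.rpow_zero 2] at h1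
  exact (Real.rpow_le_rpow_left_iff (by norm_num)).mp h1

/-- Rates per `r` bits are rates per `a` bits scaled by `a / r`. If `a = 0`, all messages are empty,
so `R = 0` and the zero tuple serves as `R'`. -/
theorem IsIndep.exists_smul_eq (loopless : ∀ j, ¬ G.Adj j j) {S : Finset (MessageTuple t)}
    (hS : IsIndep G (S : Set (MessageTuple t))) {a r : ℝ} (hr : 0 < r)
    (hcard : (2 : ℝ) ^ (∑ i, t i) ≤ #S * 2 ^ a) {R : V → ℝ} (hR : ∀ j, 0 ≤ R j)
    (hRt : ∀ j, R j ≤ t j / r) : ∃ R' ∈ capacityRegion G, R = (a / r) • R' := by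
  rcases (nonneg_of_two_pow_le hcard).eq_or_lt with rfl | ha
  · refine ⟨0, hS.mem_capacityRegion one_pos (hcard.trans ?_) (by simp) (by simp), ?_⟩
    · gcongr <;> norm_num
    · funext j
      have h0 := hS.length_le loopless hcard j
      have h1 := hRt j
      have h2 : (t j : ℝ) = 0 := le_antisymm h0 (by positivity)
      rw [h2, zero_div] at h1
      simpa using le_antisymm h1 (hR j)
  · refine ⟨(r / a) • R, hS.mem_capacityRegion ha hcard (fun j => ?_) (fun j => ?_), ?_⟩
    · have := hR j
      simp only [Pi.smul_apply, smul_eq_mul]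
      positivity
    · have := hRt j
      rw [le_div_iff₀ hr] at this
      simp only [Pi.smul_apply, smul_eq_mul]
      calc a * (r / a * R j) = R j * r := by field_simp
        _ ≤ _ := this
    · rw [smul_smul, div_mul_div_cancel₀ hr.ne', div_self ha.ne', one_smul]

theorem isCompact_capacityRegion (loopless : ∀ j, ¬ G.Adj j j) :
    IsCompact (capacityRegion G) := by
  refine (isCompact_univ_pi fun _ : V => isCompact_Icc (a := (0 : ℝ)) (b := 1)).of_isClosed_subset
    isClosed_closure (closure_minimal ?_ (isClosed_set_pi fun _ _ => isClosed_Icc))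
  rintro R ⟨hR, t, r, hr, ⟨c⟩, hRt⟩ j -
  refine ⟨hR j, (hRt j).trans ?_⟩
  obtain ⟨S, hS, hcard⟩ := c.exists_isIndep
  rw [div_le_one (by exact_mod_cast hr)]
  refine hS.length_le loopless ?_ j
  rw [Real.rpow_natCast, mul_comm]
  exact_mod_cast hcard

end Rates

/-! ### Splitting and combining the two parts -/

section Parts

variable {n₁ n₂ : ℕ} {G : Digraph (Fin (n₁ + n₂))} {t : Fin (n₁ + n₂) → ℕ}

theorem firstPart_loopless (loopless : ∀ j, ¬ G.Adj j j) (j : Fin n₁) :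
    ¬ (firstPart G).Adj j j :=
  loopless _

theorem lastPart_loopless (loopless : ∀ j, ¬ G.Adj j j) (j : Fin n₂) :
    ¬ (lastPart G).Adj j j :=
  loopless _

/-- The messages of the first part. -/
def firstMessages (x : MessageTuple t) : MessageTuple (fun i => t (Fin.castAdd n₂ i)) :=
  fun i => x (Fin.castAdd n₂ i)

/-- The messages of the last part. -/
def lastMessages (x : MessageTuple t) : MessageTuple (fun i => t (Fin.natAdd n₁ i)) :=
  fun i => x (Fin.natAdd n₁ i)

theorem messageTuple_ext {x z : MessageTuple t} (h₁ : firstMessages x = firstMessages z)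
    (h₂ : lastMessages x = lastMessages z) : x = z := by
  funext i
  induction i using Fin.addCases with
  | left i => exact congrFun h₁ i
  | right i => exact congrFun h₂ i

/-- If the receivers of the first part know no message of the last part, an independent set is at
most as large as a product of independent sets for the parts. -/
theorem IsIndep.exists_parts
    (one_way : ∀ (i : Fin n₂) (j : Fin n₁), ¬ G.Adj (Fin.natAdd n₁ i) (Fin.castAdd n₂ j))
    {S : Finset (MessageTuple t)} (hS : IsIndep G (S : Set (MessageTuple t))) :
    ∃ (S₁ : Finset (MessageTuple fun i => t (Fin.castAdd n₂ i)))
      (S₂ : Finset (MessageTuple fun i => t (Fin.natAdd n₁ i))),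
      IsIndep (firstPart G) (S₁ : Set (MessageTuple fun i => t (Fin.castAdd n₂ i))) ∧
      IsIndep (lastPart G) (S₂ : Set (MessageTuple fun i => t (Fin.natAdd n₁ i))) ∧
      #S ≤ #S₁ * #S₂ := by
  obtain ⟨y, hy⟩ := Finite.exists_max fun y => #{x ∈ S | firstMessages x = y}
  -- `S₂` comes from the largest fiber of `S` over the first messages. There the first messages are
  -- constant, so edges into the last part from the first give no distinction.
  refine ⟨S.image firstMessages, {x ∈ S | firstMessages x = y}.image lastMessages, ?_, ?_, ?_⟩
  · intro x hx z hz j h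
    simp only [coe_image, Set.mem_image, mem_coe] at hx hz
    obtain ⟨x, hx, rfl⟩ := hx
    obtain ⟨z, hz, rfl⟩ := hz
    refine hS x hx z hz (Fin.castAdd n₂ j) fun k hk => ?_
    induction k using Fin.addCases with
    | left k => exact h k hk
    | right k => exact absurd hk (one_way k j)
  · intro x hx z hz j h
    simp only [coe_image, Set.mem_image, mem_coe, mem_filter] at hx hz
    obtain ⟨x, ⟨hx, hxy⟩, rfl⟩ := hx
    obtain ⟨z, ⟨hz, hzy⟩, rfl⟩ := hz
    refine hS x hx z hz (Fin.natAdd n₁ j) fun k hk => ?_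
    induction k using Fin.addCases with
    | left k => exact congrFun (hxy.trans hzy.symm) k
    | right k => exact h k hk
  · rw [Finset.card_image_of_injOn (s := {x ∈ S | firstMessages x = y})]
    · rw [mul_comm]
      refine Finset.card_le_mul_card_image S _ fun z _ => hy z
    · intro x hx z hz h
      simp only [coe_filter, Set.mem_ofPred_eq] at hx hz
      exact messageTuple_ext (hx.2.trans hz.2.symm) h

/-- Side information across the parts is simply ignored. -/
theorem IsColoring.prodMk {C₁ C₂ : Type*}
    {c₁ : MessageTuple (fun i => t (Fin.castAdd n₂ i)) → C₁} (h₁ : IsColoring (firstPart G) c₁)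
    {c₂ : MessageTuple (fun i => t (Fin.natAdd n₁ i)) → C₂} (h₂ : IsColoring (lastPart G) c₂) :
    IsColoring G (fun x => (c₁ (firstMessages x), c₂ (lastMessages x))) := by
  intro y x hx z hz j h
  induction j using Fin.addCases with
  | left j =>
    exact h₁ y.1 (firstMessages x) (congrArg Prod.fst hx) (firstMessages z)
      (congrArg Prod.fst hz) j fun k hk => h _ hk
  | right j =>
    exact h₂ y.2 (lastMessages x) (congrArg Prod.snd hx) (lastMessages z)
      (congrArg Prod.snd hz) j fun k hk => h _ hk

/-- Time sharing between `p` uses of a code for the first part and `q` uses of a code for the last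
part. -/
theorem nonempty_indexCode_append {t₁ : Fin n₁ → ℕ} {t₂ : Fin n₂ → ℕ} {r₁ r₂ p q r : ℕ}
    (c₁ : IndexCode (firstPart G) t₁ r₁) (c₂ : IndexCode (lastPart G) t₂ r₂)
    (hr : p * r₁ + q * r₂ ≤ r) :
    Nonempty (IndexCode G (Fin.append (fun i => p * t₁ i) fun i => q * t₂ i) r) := by
  have h₁ : ∃ c : MessageTuple (fun i => (Fin.append (fun i => p * t₁ i) fun i => q * t₂ i)
      (Fin.castAdd n₂ i)) → (Fin p → Fin r₁ → Bool), IsColoring (firstPart G) c := by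
    rw [show (fun i => (Fin.append (fun i => p * t₁ i) fun i => q * t₂ i) (Fin.castAdd n₂ i)) =
      fun i => p * t₁ i from funext fun i => Fin.append_left _ _ i]
    exact ⟨_, c₁.isColoring_encode.comp_copies p⟩
  have h₂ : ∃ c : MessageTuple (fun i => (Fin.append (fun i => p * t₁ i) fun i => q * t₂ i)
      (Fin.natAdd n₁ i)) → (Fin q → Fin r₂ → Bool), IsColoring (lastPart G) c := by
    rw [show (fun i => (Fin.append (fun i => p * t₁ i) fun i => q * t₂ i) (Fin.natAdd n₁ i)) =
      fun i => q * t₂ i from funext fun i => Fin.append_right _ _ i]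
    exact ⟨_, c₂.isColoring_encode.comp_copies q⟩
  obtain ⟨d₁, hd₁⟩ := h₁
  obtain ⟨d₂, hd₂⟩ := h₂
  refine (hd₁.prodMk hd₂).nonempty_indexCode ?_
  simp only [Fintype.card_prod, Fintype.card_pi, Fintype.card_bool, prod_const, card_univ,
    Fintype.card_fin, ← pow_mul, ← pow_add]
  refine Nat.pow_le_pow_right (by norm_num) ?_
  rwa [mul_comm r₁, mul_comm r₂]

theorem continuous_append_smul :
    Continuous fun p : ℝ × (Fin n₁ → ℝ) × (Fin n₂ → ℝ) =>
      Fin.append (p.1 • p.2.1) ((1 - p.1) • p.2.2) := by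
  refine continuous_pi fun i => ?_
  induction i using Fin.addCases with
  | left i => simp only [Fin.append_left, Pi.smul_apply]; fun_prop
  | right i => simp only [Fin.append_right, Pi.smul_apply]; fun_prop

theorem Achievable.append_mem_capacityRegion {R₁ : Fin n₁ → ℝ} {R₂ : Fin n₂ → ℝ}
    (h₁ : Achievable (firstPart G) R₁) (h₂ : Achievable (lastPart G) R₂) {α : ℝ}
    (hα : α ∈ Set.Icc (0 : ℝ) 1) :
    Fin.append (α • R₁) ((1 - α) • R₂) ∈ capacityRegion G := by
  obtain ⟨hR₁, t₁, r₁, hr₁, ⟨c₁⟩, hRt₁⟩ := h₁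
  obtain ⟨hR₂, t₂, r₂, hr₂, ⟨c₂⟩, hRt₂⟩ := h₂
  have hr₁' : (0 : ℝ) < r₁ := by exact_mod_cast hr₁
  have hr₂' : (0 : ℝ) < r₂ := by exact_mod_cast hr₂
  have hβ : 0 ≤ 1 - α := sub_nonneg.mpr hα.2
  have hlim : ∀ {β r : ℝ}, 0 ≤ β → 0 < r →
      Tendsto (fun m : ℕ => (⌊β / r * m⌋₊ : ℝ) / m * r) atTop (𝓝 β) := by
    intro β r hβ hr
    have := ((tendsto_nat_floor_mul_div_atTop (div_nonneg hβ hr.le)).comp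
      (tendsto_natCast_atTop_atTop (R := ℝ))).mul_const r
    rwa [div_mul_cancel₀ _ hr.ne'] at this
  -- Of `m` index bits, about `α * m` go to the first code and the rest to the last; rounding down
  -- the numbers of uses vanishes in the limit.
  have hlimR : Tendsto (fun m : ℕ => Fin.append (((⌊α / r₁ * m⌋₊ : ℝ) / m * r₁) • R₁)
      (((⌊(1 - α) / r₂ * m⌋₊ : ℝ) / m * r₂) • R₂)) atTop
      (𝓝 (Fin.append (α • R₁) ((1 - α) • R₂))) := by
    rw [tendsto_pi_nhds]
    intro i
    induction i using Fin.addCases with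
    | left i =>
      simp only [Fin.append_left, Pi.smul_apply]
      exact (hlim hα.1 hr₁').smul_const _
    | right i =>
      simp only [Fin.append_right, Pi.smul_apply]
      exact (hlim hβ hr₂').smul_const _
  refine mem_closure_of_tendsto hlimR ?_
  have hrate : ∀ {p m r R t : ℝ}, 0 ≤ p → 0 < m → 0 < r → R ≤ t / r →
      p / m * r * R ≤ p * t / m := by
    intro p m r R t hp hm hr h
    calc p / m * r * R ≤ p / m * r * (t / r) := by gcongr
      _ = p * t / m := by field_simp
  filter_upwards [eventually_gt_atTop 0] with m hm
  have hm' : (0 : ℝ) < m := by exact_mod_cast hm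
  refine ⟨fun j => ?_, Fin.append (fun i => ⌊α / r₁ * m⌋₊ * t₁ i)
    (fun i => ⌊(1 - α) / r₂ * m⌋₊ * t₂ i), m, hm, nonempty_indexCode_append c₁ c₂ ?_, fun j => ?_⟩
  · induction j using Fin.addCases with
    | left j =>
      have := hR₁ j
      simp only [Fin.append_left, Pi.smul_apply, smul_eq_mul]
      positivity
    | right j =>
      have := hR₂ j
      simp only [Fin.append_right, Pi.smul_apply, smul_eq_mul]
      positivity
  · have h1 : (⌊α / r₁ * m⌋₊ : ℝ) * r₁ ≤ α * m := by
      calc _ ≤ α / r₁ * m * r₁ := by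
            gcongr
            exact Nat.floor_le (mul_nonneg (div_nonneg hα.1 hr₁'.le) hm'.le)
        _ = α * m := by field_simp
    have h2 : (⌊(1 - α) / r₂ * m⌋₊ : ℝ) * r₂ ≤ (1 - α) * m := by
      calc _ ≤ (1 - α) / r₂ * m * r₂ := by
            gcongr
            exact Nat.floor_le (mul_nonneg (div_nonneg hβ hr₂'.le) hm'.le)
        _ = (1 - α) * m := by field_simp
    have h3 : (⌊α / r₁ * m⌋₊ : ℝ) * r₁ + (⌊(1 - α) / r₂ * m⌋₊ : ℝ) * r₂ ≤ m := by linarith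
    exact_mod_cast h3
  · induction j using Fin.addCases with
    | left j =>
      simp only [Fin.append_left, Pi.smul_apply, smul_eq_mul, Nat.cast_mul]
      exact hrate (by positivity) hm' hr₁' (hRt₁ j)
    | right j =>
      simp only [Fin.append_right, Pi.smul_apply, smul_eq_mul, Nat.cast_mul]
      exact hrate (by positivity) hm' hr₂' (hRt₂ j)

theorem append_mem_capacityRegion {R₁ : Fin n₁ → ℝ} {R₂ : Fin n₂ → ℝ}
    (h₁ : R₁ ∈ capacityRegion (firstPart G)) (h₂ : R₂ ∈ capacityRegion (lastPart G)) {α : ℝ}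
    (hα : α ∈ Set.Icc (0 : ℝ) 1) :
    Fin.append (α • R₁) ((1 - α) • R₂) ∈ capacityRegion G := by
  have hcont : Continuous fun p : (Fin n₁ → ℝ) × (Fin n₂ → ℝ) =>
      Fin.append (α • p.1) ((1 - α) • p.2) :=
    continuous_append_smul.comp (Continuous.prodMk continuous_const continuous_id)
  have hmem : (R₁, R₂) ∈ closure
      ({R | Achievable (firstPart G) R} ×ˢ {R | Achievable (lastPart G) R}) := by
    rw [closure_prod_eq]
    exact ⟨h₁, h₂⟩
  have := map_mem_closure (t := capacityRegion G) hcont hmem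
    fun p hp => hp.1.append_mem_capacityRegion hp.2 hα
  rwa [capacityRegion, closure_closure] at this

/-- The converse: a code for the whole graph splits the index length between the parts. -/
theorem Achievable.exists_append (loopless : ∀ j, ¬ G.Adj j j)
    (one_way : ∀ (i : Fin n₂) (j : Fin n₁), ¬ G.Adj (Fin.natAdd n₁ i) (Fin.castAdd n₂ j))
    {R : Fin (n₁ + n₂) → ℝ} (h : Achievable G R) :
    ∃ α ∈ Set.Icc (0 : ℝ) 1, ∃ R₁ ∈ capacityRegion (firstPart G),
      ∃ R₂ ∈ capacityRegion (lastPart G), R = Fin.append (α • R₁) ((1 - α) • R₂) := by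
  obtain ⟨hR, t, r, hr, ⟨c⟩, hRt⟩ := h
  have hr' : (0 : ℝ) < r := by exact_mod_cast hr
  obtain ⟨S, hS, hcard⟩ := c.exists_isIndep
  obtain ⟨S₁, S₂, hS₁, hS₂, hle⟩ := hS.exists_parts one_way
  rw [Fin.sum_univ_add] at hcard
  have hprod : (2 : ℝ) ^ (∑ i, t (Fin.castAdd n₂ i)) * 2 ^ (∑ i, t (Fin.natAdd n₁ i)) ≤
      2 ^ r * (#S₁ * #S₂) := by
    rw [← pow_add]
    exact_mod_cast hcard.trans (Nat.mul_le_mul_left _ hle)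
  have hpos : (0 : ℝ) < #S₁ := by
    by_contra h
    have h0 : (#S₁ : ℝ) = 0 := le_antisymm (not_lt.mp h) (by positivity)
    rw [h0, zero_mul, mul_zero] at hprod
    exact absurd hprod (not_le.mpr (by positivity))
  -- The share of the first part, usually not an integer. It makes the bound for `S₁` an equality,
  -- leaving `r - a` for `S₂`.
  set a : ℝ := ((∑ i, t (Fin.castAdd n₂ i) : ℕ) : ℝ) - Real.logb 2 #S₁ with ha
  have hcard₁ : (2 : ℝ) ^ (∑ i, t (Fin.castAdd n₂ i)) = #S₁ * 2 ^ a := by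
    rw [ha, Real.rpow_sub (by norm_num), Real.rpow_natCast,
      Real.rpow_logb (by norm_num) (by norm_num) hpos]
    field_simp
  have hcard₂ : (2 : ℝ) ^ (∑ i, t (Fin.natAdd n₁ i)) ≤ #S₂ * 2 ^ ((r : ℝ) - a) := by
    have ha0 : (0 : ℝ) < 2 ^ a := by positivity
    rw [Real.rpow_sub (by norm_num), Real.rpow_natCast, ← mul_div_assoc, le_div_iff₀ ha0]
    rw [hcard₁] at hprod
    refine le_of_mul_le_mul_left ?_ hpos
    linarith
  have ha₁ := nonneg_of_two_pow_le hcard₁.le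
  have ha₂ := nonneg_of_two_pow_le hcard₂
  obtain ⟨R₁, hR₁, hRR₁⟩ := hS₁.exists_smul_eq (firstPart_loopless loopless) hr' hcard₁.le
    (R := fun i => R (Fin.castAdd n₂ i)) (fun j => hR _) (fun j => hRt _)
  obtain ⟨R₂, hR₂, hRR₂⟩ := hS₂.exists_smul_eq (lastPart_loopless loopless) hr' hcard₂
    (R := fun i => R (Fin.natAdd n₁ i)) (fun j => hR _) (fun j => hRt _)
  refine ⟨a / r, ⟨by positivity, by rw [div_le_one hr']; linarith⟩, R₁, hR₁, R₂, hR₂, ?_⟩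
  rw [sub_div, div_self hr'.ne'] at hRR₂
  rw [← hRR₁, ← hRR₂]
  exact (Fin.append_castAdd_natAdd).symm

end Parts

end IndexCoding

/-! ### The capacity region of a one-way union -/

theorem theorem2 (n₁ n₂ : ℕ) (G : Digraph (Fin (n₁ + n₂)))
    (loopless : ∀ j, ¬ G.Adj j j)
    (one_way : ∀ (i : Fin n₂) (j : Fin n₁), ¬ G.Adj (Fin.natAdd n₁ i) (Fin.castAdd n₂ j)) :
    IndexCoding.capacityRegion G =
      ⋃ α ∈ Set.Icc (0 : ℝ) 1,
        {R : Fin (n₁ + n₂) → ℝ |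
          ∃ R₁ ∈ IndexCoding.capacityRegion (IndexCoding.firstPart G),
          ∃ R₂ ∈ IndexCoding.capacityRegion (IndexCoding.lastPart G),
            R = Fin.append (α • R₁) ((1 - α) • R₂)} := by
  -- As a continuous image of a compact product the union is closed, so the converse is needed only
  -- for achievable tuples.
  have hunion : (⋃ α ∈ Set.Icc (0 : ℝ) 1,
        {R : Fin (n₁ + n₂) → ℝ |
          ∃ R₁ ∈ IndexCoding.capacityRegion (IndexCoding.firstPart G),
          ∃ R₂ ∈ IndexCoding.capacityRegion (IndexCoding.lastPart G),
            R = Fin.append (α • R₁) ((1 - α) • R₂)}) =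
      (fun p : ℝ × (Fin n₁ → ℝ) × (Fin n₂ → ℝ) =>
        Fin.append (p.1 • p.2.1) ((1 - p.1) • p.2.2)) ''
        (Set.Icc (0 : ℝ) 1 ×ˢ IndexCoding.capacityRegion (IndexCoding.firstPart G) ×ˢ
          IndexCoding.capacityRegion (IndexCoding.lastPart G)) := by
    ext R
    simp only [Set.mem_iUnion, Set.mem_ofPred_eq, exists_prop, Set.mem_image, Set.mem_prod,
      Prod.exists]
    constructor
    · rintro ⟨α, hα, R₁, h₁, R₂, h₂, rfl⟩
      exact ⟨α, R₁, R₂, ⟨hα, h₁, h₂⟩, rfl⟩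
    · rintro ⟨α, R₁, R₂, ⟨hα, h₁, h₂⟩, rfl⟩
      exact ⟨α, hα, R₁, h₁, R₂, h₂, rfl⟩
  refine Set.Subset.antisymm (closure_minimal ?_ ?_) ?_
  · intro R hR
    simpa only [Set.mem_iUnion, Set.mem_ofPred_eq, exists_prop] using
      IndexCoding.Achievable.exists_append loopless one_way hR
  · rw [hunion]
    exact ((isCompact_Icc.prod
      ((IndexCoding.isCompact_capacityRegion (IndexCoding.firstPart_loopless loopless)).prod
        (IndexCoding.isCompact_capacityRegion (IndexCoding.lastPart_loopless loopless)))).image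
      IndexCoding.continuous_append_smul).isClosed
  · intro R hR
    simp only [Set.mem_iUnion, Set.mem_ofPred_eq, exists_prop] at hR
    obtain ⟨α, hα, R₁, h₁, R₂, h₂, rfl⟩ := hR
    exact IndexCoding.append_mem_capacityRegion h₁ h₂ hα
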